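/- Theorem 4 (Harju–Nowotka word). Let $g$ be the morphism on $\{0,1,2,3\}$ with $g(0)=01$, $g(1)=20$, $g(2)=23$, $g(3)=02$, let $\tau$ be the coding with $\tau(0)=2$, $\tau(1)=1$, $\tau(2)=0$, $\tau(3)=1$, and let $\mathbf{vtm}=\tau(g^\omega(0))=2102012101202102\cdots$. Let $\zeta$ be the morphism $$\zeta(0)=111000110010110001110010,\quad \zeta(1)=111000101100011100101100010,\quad \zeta(2)=111000110010110001011100101100,$$ whose image lengths $24, 27, 30$ are in arithmetic progression. Then: (1) the set of squares $uu$ ($u$ a nonempty word) that occur as contiguous subwords of the infinite binary word $\zeta(\mathbf{vtm})$ is exactly $\{0^2, 1^2, (01)^2\}$; (2) $\zeta(\mathbf{vtm})$ is generated by a $2$-automaton with $88$ states, that is, a deterministic finite automaton with output that reads the base-$2$ representation of $n$, most significant digit first, and outputs the $n$-th letter ($n\ge 0$); no $2$-automaton with fewer states generates it; (3) consequently its weight as a $2$-automatic word is $2\cdot 88=176$: the least weight $\sum_{a\in\Sigma}|h(a)|$ of a $2$-uniform morphism $h:\Sigma^*\to\Sigma^*$, $\Sigma$ a finite alphabet,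 such that $\zeta(\mathbf{vtm})$ is the image under a coding of a fixed point $h^\omega(a)$, is $176$. -/

import Mathlib

namespace FewSquares

/-- The extension to finite words of the morphism given on letters by `h`:
`h (a₁ ⋯ aₙ) = h a₁ ⋯ h aₙ`. -/
def applyWord {α β : Type*} (h : α → List β) (w : List α) : List β :=
  w.flatMap h

/-- The morphism `h` is `k`-uniform: every letter has an image of length `k`. -/
def IsUniform {α β : Type*} (k : ℕ) (h : α → List β) : Prop :=
  ∀ a, (h a).length = k

/-- The condition under which `h` generates an infinite word from the letter `a`:
`h a = a w` for a word `w` with `hⁱ w` nonempty for every `i`. -/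
def IsProlongable {α : Type*} (h : α → List α) (a : α) : Prop :=
  ∃ w : List α, h a = a :: w ∧ ∀ i : ℕ, (applyWord h)^[i] w ≠ []

/-- The infinite word `h^ω a = a w (h w) (h² w) ⋯` for `h` prolongable on `a`. In that case
`hⁱ a` is a prefix of it of length at least `i + 1` for every `i`, so its letter number `n`
is the letter number `n` of `hⁿ⁺¹ a` (the default value `a` is never used). -/
def omegaWord {α : Type*} (h : α → List α) (a : α) (n : ℕ) : α :=
  ((applyWord h)^[n + 1] [a]).getD n a

/-- The image `h (x 0) h (x 1) h (x 2) ⋯` of an infinite word `x` under a morphism `h` with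
nonempty images: the image of the first `n + 1` letters has more than `n` letters, and its letter
number `n` is the letter number `n` of the image (the default value is never used). -/
def applyInfWord {α β : Type*} [Inhabited β] (h : α → List β) (x : ℕ → α) (n : ℕ) : β :=
  (applyWord h ((List.range (n + 1)).map x)).getD n default

/-- The finite word `w` is a factor (contiguous subword) of the infinite word `x`. -/
def IsFactor {α : Type*} (w : List α) (x : ℕ → α) : Prop :=
  ∃ i : ℕ, w = (List.range w.length).map fun j => x (i + j)

/-- The set of squares `u u`, with `u` nonempty, that occur in the infinite word `x`. -/
def squaresIn {α : Type*} (x : ℕ → α) : Set (List α) :=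
  {w | ∃ u : List α, u ≠ [] ∧ w = u ++ u ∧ IsFactor w x}

/-- A deterministic finite automaton with output in `β`, state set `Q` and input alphabet
`{0, …, k - 1}`. -/
structure DFAO (k : ℕ) (β Q : Type*) where
  /-- The transition function. -/
  step : Q → Fin k → Q
  /-- The initial state. -/
  start : Q
  /-- The output attached to each state. -/
  out : Q → β

/-- The base-`k` representation of `n`, most significant digit first, without leading zeros
(`k ≥ 2`; the representation of `0` is empty). -/
def baseRep (k : ℕ) [NeZero k] (n : ℕ) : List (Fin k) :=
  (Nat.digits k n).reverse.map (Fin.ofNat k)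

/-- The automaton `A` generates the infinite word `x`: after reading the base-`k` representation
of `n`, most significant digit first, it is in a state with output `x n`. -/
def DFAO.Generates {k : ℕ} [NeZero k] {β Q : Type*} (A : DFAO k β Q) (x : ℕ → β) : Prop :=
  ∀ n : ℕ, A.out ((baseRep k n).foldl A.step A.start) = x n

/-- The numbers `s` such that some `k`-automaton with `s` states generates `x`. -/
def stateCounts (k : ℕ) [NeZero k] {β : Type*} (x : ℕ → β) : Set ℕ :=
  {s | ∃ A : DFAO k β (Fin s), A.Generates x}

/-- The weight of a morphism: the sum of the lengths of the images of the letters. -/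
def weight {α β : Type*} [Fintype α] (h : α → List β) : ℕ :=
  ∑ a, (h a).length

/-- The weights of the `k`-uniform morphisms `h` that define `x`, that is, for which `x` is the
image of a fixed point `h^ω a` under a coding `c`. -/
def automaticWeights (k : ℕ) {β : Type*} (x : ℕ → β) : Set ℕ :=
  {m | ∃ (s : ℕ) (h : Fin s → List (Fin s)) (a : Fin s) (c : Fin s → β),
    IsUniform k h ∧ IsProlongable h a ∧ (∀ n, x n = c (omegaWord h a n)) ∧ weight h = m}

/-- The morphism `0 ↦ 01`, `1 ↦ 20`, `2 ↦ 23`, `3 ↦ 02`. -/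
def vtmMorphism : Fin 4 → List (Fin 4) :=
  ![[0, 1], [2, 0], [2, 3], [0, 2]]

/-- The coding `0 ↦ 2`, `1 ↦ 1`, `2 ↦ 0`, `3 ↦ 1`. -/
def vtmCoding : Fin 4 → Fin 3 :=
  ![2, 1, 0, 1]

/-- The squarefree word `2102012101202102⋯` over `{0, 1, 2}`. -/
def vtm (n : ℕ) : Fin 3 :=
  vtmCoding (omegaWord vtmMorphism 0 n)

/-- The Harju–Nowotka morphism. -/
def zeta : Fin 3 → List (Fin 2) :=
  ![[1, 1, 1, 0, 0, 0, 1, 1, 0, 0, 1, 0, 1, 1, 0, 0, 0, 1, 1, 1, 0, 0, 1, 0],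
    [1, 1, 1, 0, 0, 0, 1, 0, 1, 1, 0, 0, 0, 1, 1, 1, 0, 0, 1, 0, 1, 1, 0, 0, 0, 1, 0],
    [1, 1, 1, 0, 0, 0, 1, 1, 0, 0, 1, 0, 1, 1, 0, 0, 0, 1, 0, 1, 1, 1, 0, 0, 1, 0, 1, 1, 0, 0]]

/-- The infinite binary word `ζ(vtm)`. -/
def zetaVtm : ℕ → Fin 2 :=
  applyInfWord zeta vtm

end FewSquares

/-! Let `t` be the Thue–Morse word. The letter of `vtm` at `n` is `1 + t (n + 1) - t n`, and the
image of the letter `a` under `zeta` has length `24 + 3 a`, so lengths telescope: image number `n`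
starts at `27 n + 3 t n`. Cut at the multiples of 27, `ζ(vtm)` becomes a 2-automatic sequence of
only five different blocks (`zetaVtm_block`).

Automata: for `N = 27 n + r`, appending a digit to `N` appends the carry of `2 r + i` to `n`. This
gives `5 * 27 = 135` states (`blockDFAO_run`), which merge into 88 classes; inputs of length at most
3 separate the classes, so 88 is least. A 2-uniform morphism with a prolongable letter is an
automaton whose start has a loop on 0. The minimal automaton has this loop, so the least weight is
twice 88.

Squares: if the period is at least 90, the markers `111000`, found exactly where images of letters
start, force 27 to divide it (`dvd_of_square`). The square then shifts blocks onto blocks and yields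
an overlap in `t`, which has none (`not_square_of_le`). Periods below 90 are checked on the finitely
many words of 8 consecutive blocks (`mem_of_square`). -/

namespace FewSquares

/-! ### 2-automata and 2-uniform morphisms -/

/-- The state reached by a 2-automaton on the base-2 representation of `n`. -/
def DFAO.run {β Q : Type*} (A : DFAO 2 β Q) (n : ℕ) : Q :=
  (baseRep 2 n).foldl A.step A.start

theorem baseRep_zero : baseRep 2 0 = [] := by simp [baseRep]

theorem baseRep_two_mul_add {n : ℕ} (i : Fin 2) (h : n ≠ 0 ∨ i ≠ 0) :
    baseRep 2 (2 * n + i) = baseRep 2 n ++ [i] := by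
  have hd : Nat.digits 2 (2 * n + i) = (i : ℕ) :: Nat.digits 2 n := by
    rw [add_comm]
    refine Nat.digits_add 2 (by norm_num) _ _ i.2 ?_
    rcases h with h | h
    · exact Or.inr h
    · exact Or.inl fun h0 => h (Fin.ext h0)
  simp [baseRep, hd]

/-- Positivity of `n` protects zeros at the start of `w` from being leading zeros, so any word can
be used to test the state reached on `n`. -/
theorem baseRep_append {n : ℕ} (hn : n ≠ 0) (w : List (Fin 2)) :
    ∃ m, baseRep 2 m = baseRep 2 n ++ w := by
  induction w using List.reverseRecOn with
  | nil => exact ⟨n, by simp⟩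
  | append_singleton w i ih =>
    obtain ⟨m, hm⟩ := ih
    refine ⟨2 * m + i, ?_⟩
    rw [baseRep_two_mul_add i, hm, List.append_assoc]
    left
    rintro rfl
    rw [baseRep_zero] at hm
    have h0 := (List.append_eq_nil_iff.1 hm.symm).1
    rw [baseRep, List.map_eq_nil_iff, List.reverse_eq_nil_iff,
      Nat.digits_eq_nil_iff_eq_zero] at h0
    exact hn h0

theorem DFAO.run_zero {β Q : Type*} (A : DFAO 2 β Q) : A.run 0 = A.start := by
  simp [DFAO.run, baseRep_zero]

/-- The loop at the start makes up for the empty representation of 0, on which no digit is read. -/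
theorem DFAO.run_two_mul_add {β Q : Type*} (A : DFAO 2 β Q) (h0 : A.step A.start 0 = A.start)
    (n : ℕ) (i : Fin 2) : A.run (2 * n + i) = A.step (A.run n) i := by
  by_cases h : n ≠ 0 ∨ i ≠ 0
  · simp [DFAO.run, baseRep_two_mul_add i h]
  · push Not at h
    obtain ⟨rfl, rfl⟩ := h
    simp [DFAO.run_zero, h0]

theorem DFAO.run_two_mul {β Q : Type*} (A : DFAO 2 β Q) (h0 : A.step A.start 0 = A.start)
    (n : ℕ) : A.run (2 * n) = A.step (A.run n) 0 := by
  simpa using A.run_two_mul_add h0 n 0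

theorem DFAO.run_two_mul_add_one {β Q : Type*} (A : DFAO 2 β Q) (h0 : A.step A.start 0 = A.start)
    (n : ℕ) : A.run (2 * n + 1) = A.step (A.run n) 1 := by
  simpa using A.run_two_mul_add h0 n 1

theorem iterate_applyWord {α : Type*} {h : α → List α} {y : ℕ → α}
    (hy : ∀ n, h (y n) = [y (2 * n), y (2 * n + 1)]) (k : ℕ) :
    (applyWord h)^[k] [y 0] = (List.range (2 ^ k)).map y := by
  have key : ∀ m, applyWord h ((List.range m).map y) = (List.range (2 * m)).map y := by
    intro m
    induction m with
    | zero => simp [applyWord]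
    | succ m ih =>
      rw [List.range_succ, show 2 * (m + 1) = 2 * m + 1 + 1 by ring, List.range_succ,
        List.range_succ]
      simp only [applyWord] at ih
      simp [applyWord, ih, hy]
  induction k with
  | zero => simp
  | succ k ih => rw [Function.iterate_succ_apply', ih, key, pow_succ, mul_comm]

theorem omegaWord_eq {α : Type*} {h : α → List α} {y : ℕ → α}
    (hy : ∀ n, h (y n) = [y (2 * n), y (2 * n + 1)]) (n : ℕ) :
    omegaWord h (y 0) n = y n := by
  have hn : n < 2 ^ (n + 1) := (Nat.lt_two_pow_self).trans (Nat.pow_lt_pow_right (by norm_num)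
    (Nat.lt_succ_self n))
  rw [omegaWord, iterate_applyWord hy, List.getD_eq_getElem _ _ (by simpa using hn)]
  simp

theorem applyWord_iterate_ne_nil {α : Type*} {h : α → List α} (hh : ∀ a, h a ≠ [])
    {w : List α} (hw : w ≠ []) (i : ℕ) : (applyWord h)^[i] w ≠ [] := by
  induction i with
  | zero => simpa
  | succ i ih =>
    rw [Function.iterate_succ_apply']
    obtain ⟨a, l, hl⟩ := List.exists_cons_of_ne_nil ih
    simp [applyWord, hl, hh]

theorem weight_of_isUniform {s k : ℕ} {β : Type*} {h : Fin s → List β} (hh : IsUniform k h) :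
    weight h = s * k := by
  simp [weight, hh _]

/-- The 2-uniform morphism with the transitions of an automaton generates the same word. -/
theorem DFAO.Generates.mem_automaticWeights {s : ℕ} {β : Type*} {A : DFAO 2 β (Fin s)}
    {x : ℕ → β} (hA : A.Generates x) (h0 : A.step A.start 0 = A.start) :
    2 * s ∈ automaticWeights 2 x := by
  have hu : IsUniform 2 fun q => [A.step q 0, A.step q 1] := fun _ => rfl
  refine ⟨s, fun q => [A.step q 0, A.step q 1], A.start, A.out, hu, ⟨[A.step A.start 1], ?_, ?_⟩,
    fun n => ?_, ?_⟩
  · simp [h0]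
  · exact applyWord_iterate_ne_nil (by simp) (by simp)
  · rw [← A.run_zero, omegaWord_eq (y := A.run)]
    · exact (hA n).symm
    · intro n
      rw [A.run_two_mul h0, A.run_two_mul_add_one h0]
  · rw [weight_of_isUniform hu, mul_comm]

/-- A 2-uniform morphism and a coding that define an infinite word give an automaton. -/
theorem exists_of_mem_automaticWeights {m : ℕ} {β : Type*} {x : ℕ → β}
    (hm : m ∈ automaticWeights 2 x) : ∃ s ∈ stateCounts 2 x, m = 2 * s := by
  obtain ⟨s, h, a, c, hu, ⟨w, hw, -⟩, hx, rfl⟩ := hm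
  let A : DFAO 2 β (Fin s) := ⟨fun q i => (h q)[(i : ℕ)]'(by rw [hu q]; exact i.2), a, c⟩
  have h0 : A.step A.start 0 = A.start := by simp [A, hw]
  refine ⟨s, ⟨A, fun n => ?_⟩, by rw [weight_of_isUniform hu, mul_comm]⟩
  have hy : ∀ n, h (A.run n) = [A.run (2 * n), A.run (2 * n + 1)] := by
    intro n
    rw [A.run_two_mul h0, A.run_two_mul_add_one h0]
    obtain ⟨p, q, hpq⟩ := List.length_eq_two.1 (hu (A.run n))
    simp [A] at hpq ⊢
    simp [hpq]
  rw [hx, show a = A.run 0 from A.run_zero.symm, omegaWord_eq hy]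
  rfl

/-- A map that respects transitions and outputs carries a generating automaton to another. -/
theorem DFAO.Generates.map {β Q R : Type*} {A : DFAO 2 β Q} {x : ℕ → β} (hA : A.Generates x)
    (B : DFAO 2 β R) (f : Q → R) (hstep : ∀ q i, B.step (f q) i = f (A.step q i))
    (hstart : B.start = f A.start) (hout : ∀ q, B.out (f q) = A.out q) : B.Generates x := by
  intro n
  rw [hstart, List.foldl_hom f (g₁ := A.step) (g₂ := B.step) hstep, hout]
  exact hA n

/-- If `s` states of a generating automaton are reached by positive integers and pairwise
distinguishable, then every generating automaton has at least `s` states. -/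
theorem DFAO.Generates.le_of_mem_stateCounts {β Q : Type*} {A : DFAO 2 β Q} {x : ℕ → β}
    (hA : A.Generates x) {s : ℕ} (q : Fin s → Q) (hq : ∀ k, ∃ n, n ≠ 0 ∧ A.run n = q k)
    (hd : ∀ k l, (∀ w : List (Fin 2), A.out (w.foldl A.step (q k)) = A.out (w.foldl A.step (q l))) →
      k = l) {t : ℕ} (ht : t ∈ stateCounts 2 x) : s ≤ t := by
  obtain ⟨B, hB⟩ := ht
  choose N hN0 hN using hq
  -- The state of `B` after `N k` has the same outputs on all continuations as `q k`, so it
  -- determines `k`.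
  have key : ∀ (k : Fin s) (w : List (Fin 2)), B.out (w.foldl B.step (B.run (N k))) = A.out (w.foldl A.step (q k)) := by
    intro k w
    obtain ⟨m, hm⟩ := baseRep_append (hN0 k) w
    have h1 := hB m
    have h2 := hA m
    rw [hm, List.foldl_append] at h1 h2
    rw [← hN k]
    exact h1.trans h2.symm
  have hinj : Function.Injective fun k => B.run (N k) := by
    intro k l hkl
    apply hd
    intro w
    rw [← key k, ← key l]
    simp only at hkl
    rw [hkl]
  simpa using Fintype.card_le_of_injective _ hinj


/-! ### Cutting `ζ(vtm)` into blocks of length 27 -/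

/-- A 2-uniform morphism on five letters. The letters stand for the triples
`(t (n - 1), t n, t (n + 1))` of letters of the Thue–Morse word `t`, up to `t (n - 1)` if
`t n = 0`. -/
def blockMorphism : Fin 5 → Fin 2 → Fin 5 :=
  ![![0, 1], ![4, 0], ![4, 3], ![0, 2], ![2, 3]]

/-- The number of the block of length 27 at position `27 n` of `ζ(vtm)`. -/
def block : ℕ → Fin 5 :=
  DFAO.run ⟨blockMorphism, 0, id⟩

/-- The letter `t n` of the Thue–Morse word, as a function of `block n`. -/
def thueMorse : Fin 5 → ℕ := ![0, 1, 1, 0, 1]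

/-- The letter `t (n + 1)` of the Thue–Morse word, as a function of `block n`. -/
def thueMorseNext : Fin 5 → ℕ := ![1, 1, 0, 0, 0]

/-- The blocks of length 27. -/
def blockWord : Fin 5 → List (Fin 2) :=
  ![(zeta 2).take 27, [1, 0, 0] ++ (zeta 1).take 24, [1, 0, 0] ++ zeta 0, zeta 1,
    [0, 1, 0] ++ zeta 0]

/-- The letter `n` of the fixed point of `vtmMorphism`, as a function of `block n`. -/
def blockLetter : Fin 5 → Fin 4 := ![0, 1, 2, 3, 2]

theorem block_zero : block 0 = 0 := DFAO.run_zero _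

theorem block_two_mul (n : ℕ) : block (2 * n) = blockMorphism (block n) 0 :=
  DFAO.run_two_mul _ rfl n

theorem block_two_mul_add_one (n : ℕ) : block (2 * n + 1) = blockMorphism (block n) 1 :=
  DFAO.run_two_mul_add_one _ rfl n

theorem length_blockWord : ∀ β, (blockWord β).length = 27 := by decide

/-- `blockLetter` carries `blockMorphism` to `vtmMorphism`, so it maps one fixed point to the other.
-/
theorem vtm_eq (n : ℕ) : vtm n = vtmCoding (blockLetter (block n)) := by
  have h : ∀ β, vtmMorphism (blockLetter β) =
      [blockLetter (blockMorphism β 0), blockLetter (blockMorphism β 1)] := by decide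
  have hy : ∀ n, vtmMorphism (blockLetter (block n)) =
      [blockLetter (block (2 * n)), blockLetter (block (2 * n + 1))] := by
    intro n
    rw [block_two_mul, block_two_mul_add_one, h]
  have h0 : (0 : Fin 4) = blockLetter (block 0) := by rw [block_zero]; rfl
  rw [vtm, h0, omegaWord_eq hy]

/-- A pair at an even position is the image of one block; a pair at an odd position straddles the
images of a pair about half as far along. -/
theorem block_pair_mem (n : ℕ) : (block n, block (n + 1)) ∈
    ([(0, 1), (4, 0), (4, 3), (2, 0), (1, 4), (3, 0), (2, 3), (0, 2)] : List (Fin 5 × Fin 5)) := by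
  induction n using Nat.strong_induction_on with
  | _ n ih =>
    obtain ⟨k, rfl | rfl⟩ := Nat.even_or_odd' n
    · rw [block_two_mul, block_two_mul_add_one]
      generalize block k = β
      revert β
      decide
    · have := ih k (by omega)
      rw [show 2 * k + 1 + 1 = 2 * (k + 1) by ring, block_two_mul, block_two_mul_add_one]
      generalize block (k + 1) = γ at *
      generalize block k = β at *
      revert β γ
      decide

theorem thueMorse_block_succ (n : ℕ) :
    thueMorse (block (n + 1)) = thueMorseNext (block n) := by
  have := block_pair_mem n
  generalize block (n + 1) = γ at *
  generalize block n = β at *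
  revert β γ
  decide

theorem length_applyWord_zeta (n : ℕ) :
    (applyWord zeta ((List.range n).map vtm)).length = 27 * n + 3 * thueMorse (block n) := by
  induction n with
  | zero => rw [block_zero]; rfl
  | succ n ih =>
    have h : ∀ β, (zeta (vtmCoding (blockLetter β))).length + 3 * thueMorse β =
      27 + 3 * thueMorseNext β := by decide
    have := h (block n)
    rw [List.range_succ, List.map_append, applyWord, List.flatMap_append, List.length_append,
      ← applyWord, ih, thueMorse_block_succ]
    simp only [List.map_cons, List.map_nil, List.flatMap_cons, List.flatMap_nil, List.append_nil,
      vtm_eq]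
    omega

theorem zetaVtm_add (n r : ℕ) (hr : r < (zeta (vtm n)).length) :
    zetaVtm (27 * n + 3 * thueMorse (block n) + r) = (zeta (vtm n)).getD r 0 := by
  set N := 27 * n + 3 * thueMorse (block n) + r with hN
  have hlen := length_applyWord_zeta n
  have hlen' : (((List.range n).map vtm).flatMap zeta).length =
      27 * n + 3 * thueMorse (block n) := hlen
  obtain ⟨m, hm⟩ := Nat.exists_eq_add_of_le (show n + 1 ≤ N + 1 by omega)
  rw [zetaVtm, applyInfWord, hm, List.range_add, List.range_succ, List.map_append,
    List.map_append, applyWord, List.flatMap_append, List.flatMap_append, List.append_assoc,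
    List.getD_append_right _ _ _ _ (by rw [hlen']; omega), hlen',
    List.map_singleton, List.flatMap_singleton, List.getD_append _ _ _ _ (by omega)]
  congr 1
  omega

theorem zetaVtm_block (n r : ℕ) (hr : r < 27) :
    zetaVtm (27 * n + r) = (blockWord (block n)).getD r 0 := by
  by_cases h : 3 * thueMorse (block n) ≤ r
  · obtain ⟨s, rfl⟩ := Nat.exists_eq_add_of_le h
    have key : ∀ β : Fin 5, ∀ s < 27, 3 * thueMorse β + s < 27 →
        s < (zeta (vtmCoding (blockLetter β))).length ∧
        (zeta (vtmCoding (blockLetter β))).getD s 0 =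
          (blockWord β).getD (3 * thueMorse β + s) 0 := by decide +kernel
    obtain ⟨h1, h2⟩ := key (block n) s (by omega) hr
    rw [← h2, ← add_assoc, zetaVtm_add _ _ (by rwa [vtm_eq]), vtm_eq]
  -- Here `r` falls in the last three letters of the previous image. Block 0 has no such part, since
  -- `t 0 = 0`.
  · obtain _ | n := n
    · rw [block_zero] at h
      exact absurd (Nat.zero_le r) h
    · have key : ∀ p ∈ ([(0, 1), (4, 0), (4, 3), (2, 0), (1, 4), (3, 0), (2, 3), (0, 2)] :
          List (Fin 5 × Fin 5)), ∀ r < 27, r < 3 * thueMorse p.2 →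
          27 + r - 3 * thueMorse p.1 < (zeta (vtmCoding (blockLetter p.1))).length ∧
          3 * thueMorse p.1 ≤ 27 ∧
          (zeta (vtmCoding (blockLetter p.1))).getD (27 + r - 3 * thueMorse p.1) 0 =
            (blockWord p.2).getD r 0 := by decide +kernel
      obtain ⟨h1, h2, h3⟩ := key _ (block_pair_mem n) r hr (by simpa using h)
      rw [← h3, ← vtm_eq, ← zetaVtm_add _ _ (by rwa [vtm_eq])]
      congr 1
      dsimp only at h2 ⊢
      omega

/-! ### The automaton with 88 states -/

/-- The automaton that computes, for `N = 27 n + r` with `r < 27`, the pair `(block n, r)`. -/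
def blockDFAO : DFAO 2 (Fin 2) (Fin 5 × Fin 27) where
  step p i := (blockMorphism p.1 (Fin.ofNat 2 ((2 * p.2 + i) / 27)), Fin.ofNat 27 (2 * p.2 + i))
  start := (0, 0)
  out p := (blockWord p.1).getD p.2 0

/-- Since `2 r + i ≤ 53`, the carry `(2 r + i) / 27` is a binary digit: it is the next digit of `n`.
-/
theorem blockDFAO_run (n : ℕ) (r : Fin 27) : blockDFAO.run (27 * n + r) = (block n, r) := by
  induction h : 27 * n + (r : ℕ) using Nat.strong_induction_on generalizing n r with
  | _ N ih =>
    subst h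
    by_cases h0 : 27 * n + (r : ℕ) = 0
    · obtain ⟨rfl, hr⟩ : n = 0 ∧ (r : ℕ) = 0 := by omega
      obtain rfl : r = 0 := Fin.ext hr
      rw [block_zero]
      exact DFAO.run_zero _
    have hr := r.2
    obtain ⟨m, i, hm⟩ : ∃ (m : ℕ) (i : Fin 2), 27 * n + (r : ℕ) = 2 * m + i :=
      ⟨(27 * n + r) / 2, Fin.ofNat 2 (27 * n + r), by simp only [Fin.ofNat]; omega⟩
    have hi := i.2
    have hrec := ih m (by omega) (m / 27) (Fin.ofNat 27 m) (by simp only [Fin.ofNat]; omega)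
    rw [hm, DFAO.run_two_mul_add _ rfl, hrec]
    simp only [blockDFAO, Prod.mk.injEq, Fin.ofNat]
    refine ⟨?_, Fin.ext (by dsimp only; omega)⟩
    obtain ⟨k, rfl | rfl⟩ := Nat.even_or_odd' n
    · rw [block_two_mul, show m / 27 = k by omega]
      congr 1
      exact Fin.ext (by simp; omega)
    · rw [block_two_mul_add_one, show m / 27 = k by omega]
      congr 1
      exact Fin.ext (by simp; omega)

theorem blockDFAO_generates : blockDFAO.Generates zetaVtm := by
  intro n
  have h := blockDFAO_run (n / 27) (Fin.ofNat 27 n)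
  have hn : 27 * (n / 27) + n % 27 = n := Nat.div_add_mod n 27
  have hz := zetaVtm_block (n / 27) (n % 27) (Nat.mod_lt _ (by norm_num))
  simp only [Fin.ofNat] at h
  rw [hn] at h hz
  rw [hz, ← DFAO.run, h]
  rfl

theorem exists_blockDFAO_run (p : Fin 5 × Fin 27) : ∃ n, n ≠ 0 ∧ blockDFAO.run n = p := by
  obtain ⟨β, r⟩ := p
  have h1 : block 1 = 1 := (block_two_mul_add_one 0).trans (by rw [block_zero]; rfl)
  have h2 : block 2 = 4 := (block_two_mul 1).trans (by rw [h1]; rfl)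
  have h3 : block 3 = 0 := (block_two_mul_add_one 1).trans (by rw [h1]; rfl)
  have h4 : block 4 = 2 := (block_two_mul 2).trans (by rw [h2]; rfl)
  have h5 : block 5 = 3 := (block_two_mul_add_one 2).trans (by rw [h2]; rfl)
  -- Position 0 is not allowed, so block 0 is taken from position 3.
  have : ∃ n, n ≠ 0 ∧ block n = β := by
    fin_cases β
    exacts [⟨3, by norm_num, h3⟩, ⟨1, by norm_num, h1⟩, ⟨4, by norm_num, h4⟩,
      ⟨5, by norm_num, h5⟩, ⟨2, by norm_num, h2⟩]
  obtain ⟨n, hn, rfl⟩ := this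
  exact ⟨27 * n + r, by omega, blockDFAO_run n r⟩

/-- Representatives of the 88 classes of indistinguishable states of `blockDFAO`. -/
def representatives : List (Fin 5 × Fin 27) :=
  [(2, 19), (3, 7), (0, 4), (3, 22), (0, 23), (3, 17), (0, 14), (3, 19), (0, 11), (1, 15),
  (2, 17), (1, 25), (2, 23), (1, 19), (3, 23), (1, 6), (0, 8), (2, 12), (1, 13), (0, 9), (1, 1),
  (1, 7), (1, 26), (2, 26), (1, 22), (3, 26), (0, 18), (2, 11), (4, 0), (1, 8), (2, 18), (0, 16),
  (3, 12), (2, 24), (1, 20), (0, 5), (0, 15), (3, 10), (1, 2), (1, 14), (0, 22), (3, 24), (0, 3),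
  (0, 25), (1, 10), (0, 2), (0, 7), (0, 26), (1, 3), (3, 25), (0, 17), (2, 25), (0, 20), (3, 14),
  (1, 9), (2, 15), (1, 21), (0, 21), (2, 22), (1, 18), (1, 4), (3, 8), (1, 12), (1, 0), (2, 13),
  (3, 9), (1, 16), (4, 1), (1, 17), (0, 24), (0, 1), (1, 11), (1, 24), (3, 20), (0, 12), (2, 21),
  (1, 5), (3, 15), (0, 13), (0, 10), (3, 21), (3, 18), (0, 19), (0, 6), (2, 20), (1, 23), (2, 10),
  (0, 0)]

/-- The class of the state `(β, r)` of `blockDFAO` has the number at index `27 β + r`. -/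
def classNumbers : List (Fin 88) :=
  [87, 70, 45, 42, 2, 35, 83, 46, 16, 19, 79, 8, 74, 78, 6, 36, 31, 50, 26, 82, 52, 57, 40, 4, 69,
  43, 47, 63, 20, 38, 48, 60, 76, 15, 21, 29, 54, 44, 71, 62, 18, 39, 9, 66, 68, 59, 13, 34, 56,
  24, 85, 72, 11, 22, 63, 20, 38, 48, 60, 76, 15, 21, 29, 54, 86, 27, 17, 64, 39, 55, 66, 10, 30,
  0, 84, 75, 58, 12, 33, 51, 23, 87, 70, 45, 42, 2, 35, 83, 1, 61, 65, 37, 8, 32, 78, 53, 77, 31,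
  5, 81, 7, 73, 80, 3, 14, 41, 49, 25, 28, 67, 38, 48, 60, 76, 15, 21, 29, 54, 86, 27, 17, 64, 39,
  55, 66, 10, 30, 0, 84, 75, 58, 12, 33, 51, 23]

/-- The outputs of `blockDFAO` from a state on the inputs of length at most 3. -/
def signature (p : Fin 5 × Fin 27) : ℕ :=
  Nat.ofDigits 2 (([[1, 1, 1], [1, 1, 0], [1, 0, 1], [1, 0, 0], [0, 1, 1], [0, 1, 0], [0, 0, 1],
    [0, 0, 0], [1, 1], [1, 0], [0, 1], [0, 0], [1], [0], []] : List (List (Fin 2))).map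
    fun w => (blockDFAO.out (w.foldl blockDFAO.step p) : ℕ))

theorem length_representatives : representatives.length = 88 := rfl

/-- The representatives are listed by increasing signature, so comparing neighbours is enough to
show that all signatures differ. -/
theorem isChain_signature : (representatives.map signature).IsChain (· < ·) := by
  decide +kernel

/-- The number of the class of a state of `blockDFAO`. -/
def classNumber (p : Fin 5 × Fin 27) : Fin 88 :=
  classNumbers.getD (27 * p.1 + p.2) 0

/-- The minimal automaton that generates `ζ(vtm)`. -/
def minimalDFAO : DFAO 2 (Fin 2) (Fin 88) where
  step q i := classNumber (blockDFAO.step (representatives.getD q (0, 0)) i)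
  start := classNumber (0, 0)
  out q := blockDFAO.out (representatives.getD q (0, 0))

theorem minimalDFAO_generates : minimalDFAO.Generates zetaVtm := by
  refine blockDFAO_generates.map minimalDFAO classNumber ?_ rfl ?_
  · have h : ∀ β r i, minimalDFAO.step (classNumber (β, r)) i =
        classNumber (blockDFAO.step (β, r) i) := by decide +kernel
    exact fun p => h p.1 p.2
  · have h : ∀ β r, minimalDFAO.out (classNumber (β, r)) = blockDFAO.out (β, r) := by
      decide +kernel
    exact fun p => h p.1 p.2

theorem isLeast_stateCounts : IsLeast (stateCounts 2 zetaVtm) 88 := by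
  refine ⟨⟨minimalDFAO, minimalDFAO_generates⟩, fun t ht => ?_⟩
  refine blockDFAO_generates.le_of_mem_stateCounts
    (fun k : Fin 88 => representatives.get (k.cast length_representatives.symm))
    (fun k => exists_blockDFAO_run _) (fun k l hkl => ?_) ht
  have hnd : (representatives.map signature).Nodup :=
    (List.isChain_iff_pairwise.1 isChain_signature).imp ne_of_lt
  have hs : signature (representatives.get (k.cast length_representatives.symm)) =
      signature (representatives.get (l.cast length_representatives.symm)) := by
    simp only [signature, hkl]
  have := List.inj_on_of_nodup_map hnd (List.get_mem _ _) (List.get_mem _ _) hs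
  have := List.nodup_iff_injective_get.1 hnd.of_map this
  simpa using this

theorem isLeast_automaticWeights : IsLeast (automaticWeights 2 zetaVtm) 176 := by
  refine ⟨minimalDFAO_generates.mem_automaticWeights (by decide +kernel), fun m hm => ?_⟩
  obtain ⟨s, hs, rfl⟩ := exists_of_mem_automaticWeights hm
  have := isLeast_stateCounts.2 hs
  omega


/-! ### The Thue–Morse word has no overlaps -/

theorem thueMorse_le_one : ∀ β, thueMorse β ≤ 1 := by decide

theorem thueMorse_block_two_mul (n : ℕ) :
    thueMorse (block (2 * n)) = thueMorse (block n) := by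
  rw [block_two_mul]
  generalize block n = β
  revert β
  decide

theorem thueMorse_block_two_mul_add_one (n : ℕ) :
    thueMorse (block (2 * n + 1)) = 1 - thueMorse (block n) := by
  rw [block_two_mul_add_one]
  generalize block n = β
  revert β
  decide

theorem thueMorse_no_cube (n : ℕ) : ¬(thueMorse (block n) = thueMorse (block (n + 1)) ∧
    thueMorse (block (n + 1)) = thueMorse (block (n + 2))) := by
  have h : ∀ k, thueMorse (block (2 * k)) ≠ thueMorse (block (2 * k + 1)) := by
    intro k
    have := thueMorse_le_one (block k)
    rw [thueMorse_block_two_mul, thueMorse_block_two_mul_add_one]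
    omega
  rintro ⟨h1, h2⟩
  obtain ⟨k, rfl | rfl⟩ := Nat.even_or_odd' n
  · exact h k h1
  · exact h (k + 1) h2

/-- An overlap of even period, read at every second letter, gives one of half the period. In one of
odd period, each pair of neighbours has a copy at an even position, so neighbours differ; the
letters alternate, against equality at odd distance `d`. -/
theorem thueMorse_no_overlap (d : ℕ) (hd : d ≠ 0) (i : ℕ) :
    ¬∀ j ≤ d, thueMorse (block (i + j)) = thueMorse (block (i + j + d)) := by
  induction d using Nat.strong_induction_on generalizing i with
  | _ d ih =>
    intro h
    obtain ⟨e, rfl | rfl⟩ := Nat.even_or_odd' d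
    · obtain ⟨k, rfl | rfl⟩ := Nat.even_or_odd' i
      · refine ih e (by omega) (by omega) k fun j hj => ?_
        have := h (2 * j) (by omega)
        rwa [show 2 * k + 2 * j + 2 * e = 2 * (k + j + e) by ring,
          show 2 * k + 2 * j = 2 * (k + j) by ring, thueMorse_block_two_mul,
          thueMorse_block_two_mul] at this
      · refine ih e (by omega) (by omega) k fun j hj => ?_
        have := h (2 * j) (by omega)
        rw [show 2 * k + 1 + 2 * j + 2 * e = 2 * (k + j + e) + 1 by ring,
          show 2 * k + 1 + 2 * j = 2 * (k + j) + 1 by ring, thueMorse_block_two_mul_add_one,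
          thueMorse_block_two_mul_add_one] at this
        have h1 := thueMorse_le_one (block (k + j))
        have h2 := thueMorse_le_one (block (k + j + e))
        omega
    · have halt : ∀ j < 2 * e + 1,
          thueMorse (block (i + (j + 1))) = 1 - thueMorse (block (i + j)) := by
        intro j hj
        have h1 := h j (by omega)
        have h2 := h (j + 1) (by omega)
        have h3 := thueMorse_le_one (block (i + j))
        have h4 := thueMorse_le_one (block (i + (j + 1)))
        obtain ⟨k, hk | hk⟩ := Nat.even_or_odd' (i + j)
        · have := thueMorse_block_two_mul_add_one k
          rw [← thueMorse_block_two_mul k, ← hk] at this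
          exact this
        · have := thueMorse_block_two_mul_add_one (k + e + 1)
          rw [← thueMorse_block_two_mul (k + e + 1), show 2 * (k + e + 1) + 1 = i + (j + 1) + (2 * e + 1) by
            omega, show 2 * (k + e + 1) = i + j + (2 * e + 1) by omega, ← h1, ← h2] at this
          exact this
      have hpar : ∀ j ≤ e, thueMorse (block (i + 2 * j)) = thueMorse (block i) := by
        intro j
        induction j with
        | zero => simp
        | succ j ihj =>
          intro hj
          have h1 := halt (2 * j) (by omega)
          have h2 := halt (2 * j + 1) (by omega)
          have h3 := thueMorse_le_one (block (i + 2 * j))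
          have h4 := ihj (by omega)
          rw [show i + 2 * (j + 1) = i + (2 * j + 1 + 1) by ring]
          omega
      have h1 := halt (2 * e) (by omega)
      have h2 := hpar e le_rfl
      have h3 := h 0 (by omega)
      have h4 := thueMorse_le_one (block i)
      rw [add_zero] at h3
      omega

/-! ### Squares of long period -/

theorem flatMap_blockWord (n k : ℕ) :
    ((List.range k).map fun j => block (n + j)).flatMap blockWord =
      (List.range (27 * k)).map fun j => zetaVtm (27 * n + j) := by
  induction k with
  | zero => rfl
  | succ k ih =>
    rw [List.range_succ, List.map_append, List.flatMap_append, ih, mul_add, mul_one,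
      List.range_add, List.map_append, List.map_map, List.map_singleton, List.flatMap_singleton]
    congr 1
    refine List.ext_getElem (by simp [length_blockWord]) fun r h1 h2 => ?_
    have hr : r < 27 := by simpa using h2
    have := zetaVtm_block (n + k) r hr
    rw [List.getD_eq_getElem _ _ h1] at this
    rw [← this]
    simp only [List.getElem_map, List.getElem_range, Function.comp_apply]
    congr 1
    ring

/-- The word `111000` occurs in `ζ(vtm)` at position `i`. -/
def IsMarker (i : ℕ) : Prop :=
  (List.range 6).map (fun j => zetaVtm (i + j)) = [1, 1, 1, 0, 0, 0]

theorem isMarker_iff (n r : ℕ) (hr : r < 27) :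
    IsMarker (27 * n + r) ↔ r = 3 * thueMorse (block n) := by
  have h := flatMap_blockWord n 2
  have key : ∀ p ∈ ([(0, 1), (4, 0), (4, 3), (2, 0), (1, 4), (3, 0), (2, 3), (0, 2)] :
      List (Fin 5 × Fin 5)), ∀ r < 27,
      (((blockWord p.1 ++ blockWord p.2).drop r).take 6 = [1, 1, 1, 0, 0, 0] ↔
        r = 3 * thueMorse p.1) := by decide +kernel
  rw [← key _ (block_pair_mem n) r hr, IsMarker]
  have h2 : blockWord (block n) ++ blockWord (block (n + 1)) =
      (List.range (27 * 2)).map fun j => zetaVtm (27 * n + j) := by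
    rw [← h]
    simp [List.range_succ]
  have h3 : (((List.range (27 * 2)).map fun j => zetaVtm (27 * n + j)).drop r).take 6 =
      (List.range 6).map fun j => zetaVtm (27 * n + r + j) := by
    refine List.ext_getElem (by simp; omega) fun j _ _ => ?_
    simp [add_assoc]
  rw [h2, h3]

theorem dvd_of_square {i p : ℕ} (hp : 90 ≤ p)
    (h : ∀ j < p, zetaVtm (i + j) = zetaVtm (i + j + p)) : 27 ∣ p := by
  have hdiv := Nat.div_add_mod p 27
  set d := p / 27
  set e := p % 27 with he
  have he27 : e < 27 := Nat.mod_lt _ (by norm_num)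
  have hi := Nat.div_add_mod i 27
  have hir : i % 27 < 27 := Nat.mod_lt _ (by norm_num)
  set m := i / 27
  -- These three markers end at `27 (m + 3) + 8 ≤ i + 89` at the latest, inside the first half of
  -- the square; hence the bound 90. A nonzero `e` would make three consecutive letters of `t`
  -- equal.
  have key : ∀ n, m + 1 ≤ n → n ≤ m + 3 → e = 0 ∨ (e = 3 ∧ thueMorse (block n) = 0) ∨
      (e = 24 ∧ thueMorse (block n) = 1) := by
    intro n h1 h2
    have ht := thueMorse_le_one (block n)
    have hm := (isMarker_iff n (3 * thueMorse (block n)) (by omega)).2 rfl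
    have hm' : IsMarker (27 * n + 3 * thueMorse (block n) + p) := by
      rw [IsMarker] at hm ⊢
      rw [← hm]
      refine List.map_congr_left fun j hj => ?_
      have hj6 : j < 6 := List.mem_range.1 hj
      have := h (27 * n + 3 * thueMorse (block n) + j - i) (by omega)
      rw [show i + (27 * n + 3 * thueMorse (block n) + j - i) =
        27 * n + 3 * thueMorse (block n) + j by omega] at this
      rw [this]
      congr 1
      ring
    by_cases hlt : 3 * thueMorse (block n) + e < 27
    · rw [show 27 * n + 3 * thueMorse (block n) + p =
        27 * (n + d) + (3 * thueMorse (block n) + e) by omega, isMarker_iff _ _ hlt] at hm'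
      have := thueMorse_le_one (block (n + d))
      omega
    · rw [show 27 * n + 3 * thueMorse (block n) + p =
        27 * (n + d + 1) + (3 * thueMorse (block n) + e - 27) by omega,
        isMarker_iff _ _ (by omega)] at hm'
      have := thueMorse_le_one (block (n + d + 1))
      omega
  have h1 := key (m + 1) (by omega) (by omega)
  have h2 := key (m + 2) (by omega) (by omega)
  have h3 := key (m + 3) (by omega) (by omega)
  have := thueMorse_no_cube (m + 1)
  rw [show m + 1 + 1 = m + 2 by ring, show m + 1 + 2 = m + 3 by ring] at this
  refine Nat.dvd_of_mod_eq_zero ?_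
  rw [← he]
  omega

theorem not_square_of_le {i p : ℕ} (hp : 90 ≤ p) :
    ¬∀ j < p, zetaVtm (i + j) = zetaVtm (i + j + p) := by
  intro h
  obtain ⟨d, rfl⟩ := dvd_of_square hp h
  have hi := Nat.div_add_mod i 27
  have hir : i % 27 < 27 := Nat.mod_lt _ (by norm_num)
  set m := i / 27
  set r := i % 27
  have hletter : ∀ n s, s < 27 → i ≤ 27 * n + s → 27 * n + s < i + 27 * d →
      (blockWord (block n)).getD s 0 = (blockWord (block (n + d))).getD s 0 := by
    intro n s hs h1 h2
    have := h (27 * n + s - i) (by omega)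
    rw [← zetaVtm_block _ _ hs, ← zetaVtm_block _ _ hs]
    rw [show i + (27 * n + s - i) = 27 * n + s by omega] at this
    rw [this]
    congr 1
    ring
  have hfull : ∀ j, 1 ≤ j → j < d → block (m + j) = block (m + j + d) := by
    have hinj : ∀ β γ, (∀ s < 27, (blockWord β).getD s 0 = (blockWord γ).getD s 0) → β = γ := by
      decide +kernel
    intro j h1 h2
    exact hinj _ _ fun s hs => hletter _ s hs (by omega) (by omega)
  -- The square may start inside a block. Wherever the cut `r` is, either the part of block `m`
  -- after it fixes `t m`, or the part of block `m + d` before it fixes `t (m + d + 1)`, well enough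
  -- to extend the repetition in `t` by one letter, on the left or on the right.
  have hborder : thueMorse (block m) = thueMorse (block (m + d)) ∨
      thueMorseNext (block (m + d)) = thueMorseNext (block (m + d + d)) := by
    have key : ∀ (r : Fin 27) (β γ δ : Fin 5),
        (∀ s : Fin 27, r ≤ s → (blockWord β).getD s 0 = (blockWord γ).getD s 0) →
        (∀ s : Fin 27, s < r → (blockWord γ).getD s 0 = (blockWord δ).getD s 0) →
        thueMorse β = thueMorse γ ∨ thueMorseNext γ = thueMorseNext δ := by decide +kernel
    refine key ⟨r, hir⟩ _ _ _ (fun s hrs => hletter m s s.2 ?_ ?_)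
      (fun s hrs => hletter (m + d) s s.2 ?_ ?_) <;>
    · have := s.2
      simp only [Fin.le_def, Fin.lt_def] at hrs
      omega
  have hlast : thueMorse (block (m + d)) = thueMorse (block (m + d + d)) := by
    have := hfull (d - 1) (by omega) (by omega)
    rw [show m + d = m + (d - 1) + 1 by omega, thueMorse_block_succ, this,
      show m + (d - 1) + 1 + d = m + (d - 1) + d + 1 by omega, thueMorse_block_succ]
  rcases hborder with hb | hb
  · refine thueMorse_no_overlap d (by omega) m fun j hj => ?_
    rcases Nat.eq_zero_or_pos j with rfl | hj0
    · exact hb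
    · rcases hj.lt_or_eq with hjd | rfl
      · rw [hfull j hj0 hjd]
      · exact hlast
  · refine thueMorse_no_overlap d (by omega) (m + 1) fun j hj => ?_
    rcases hj.lt_or_eq with hjd | rfl
    · by_cases hjd' : j + 1 < d
      · rw [show m + 1 + j = m + (j + 1) by ring, hfull (j + 1) (by omega) hjd']
      · rw [show m + 1 + j = m + d by omega]
        exact hlast
    · rw [show m + 1 + j = m + j + 1 by ring, thueMorse_block_succ, hb,
        show m + j + 1 + j = m + j + j + 1 by ring, thueMorse_block_succ]

/-! ### Squares of short period -/

/-- The words of 8 consecutive blocks. -/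
def blockWindows : List (List (Fin 5)) :=
  [[0, 1, 4, 0, 2, 3, 0, 1], [0, 1, 4, 0, 2, 3, 0, 2], [0, 1, 4, 3, 0, 1, 4, 0],
   [0, 1, 4, 3, 0, 2, 0, 1], [0, 2, 0, 1, 4, 0, 2, 3], [0, 2, 0, 1, 4, 3, 0, 1],
   [0, 2, 3, 0, 1, 4, 3, 0], [0, 2, 3, 0, 2, 0, 1, 4], [1, 4, 0, 2, 3, 0, 1, 4],
   [1, 4, 0, 2, 3, 0, 2, 0], [1, 4, 3, 0, 1, 4, 0, 2], [1, 4, 3, 0, 2, 0, 1, 4],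
   [2, 0, 1, 4, 0, 2, 3, 0], [2, 0, 1, 4, 3, 0, 1, 4], [2, 3, 0, 1, 4, 3, 0, 2],
   [2, 3, 0, 2, 0, 1, 4, 0], [2, 3, 0, 2, 0, 1, 4, 3], [3, 0, 1, 4, 0, 2, 3, 0],
   [3, 0, 1, 4, 3, 0, 2, 0], [3, 0, 2, 0, 1, 4, 0, 2], [3, 0, 2, 0, 1, 4, 3, 0],
   [4, 0, 2, 3, 0, 1, 4, 3], [4, 0, 2, 3, 0, 2, 0, 1], [4, 3, 0, 1, 4, 0, 2, 3],
   [4, 3, 0, 2, 0, 1, 4, 0], [4, 3, 0, 2, 0, 1, 4, 3]]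

theorem block_window_mem (n : ℕ) :
    (List.range 8).map (fun j => block (n + j)) ∈ blockWindows := by
  -- The window at `n` lies in the image of the window at `n / 2`, at offset `n % 2`.
  have hstep : ∀ w ∈ blockWindows, ∀ i : Fin 2,
      ((w.flatMap fun β => [blockMorphism β 0, blockMorphism β 1]).drop i).take 8 ∈
        blockWindows := by decide +kernel
  have hflat : ∀ n k, ((List.range k).map fun j => block (n + j)).flatMap
      (fun β => [blockMorphism β 0, blockMorphism β 1]) =
        (List.range (2 * k)).map fun j => block (2 * n + j) := by
    intro n k
    induction k with
    | zero => rfl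
    | succ k ih =>
      rw [List.range_succ, List.map_append, List.flatMap_append, ih, mul_add, mul_one,
        List.range_add, List.map_append, List.map_map, List.map_singleton,
        List.flatMap_singleton, ← block_two_mul, ← block_two_mul_add_one]
      simp [List.range_succ, mul_add, add_assoc]
  induction n using Nat.strong_induction_on with
  | _ n ih =>
    obtain rfl | hn := Nat.eq_zero_or_pos n
    · have hpre : ∀ k, (List.range (2 ^ k)).map block =
          (applyWord fun β => [blockMorphism β 0, blockMorphism β 1])^[k] [0] := by
        intro k
        rw [← block_zero, iterate_applyWord (y := block)]
        intro n
        rw [block_two_mul, block_two_mul_add_one]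
      simp only [zero_add]
      rw [show (8 : ℕ) = 2 ^ 3 from rfl, hpre]
      decide +kernel
    · have hlt : n / 2 < n := by omega
      have := hstep _ (ih _ hlt) (Fin.ofNat 2 n)
      rw [hflat] at this
      convert this using 1
      refine List.ext_getElem (by simp [Fin.ofNat]; omega) fun j _ _ => ?_
      simp only [List.getElem_map, List.getElem_range, List.getElem_take, List.getElem_drop,
        Fin.ofNat]
      congr 1
      omega

/-- The words `s` and `t` differ at one of their first `k` letters. -/
def mismatch : List (Fin 2) → List (Fin 2) → ℕ → Bool
  | a :: s, b :: t, k + 1 => a != b || mismatch s t k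
  | _, _, _ => false

theorem exists_of_mismatch {s t : List (Fin 2)} {k : ℕ} (h : mismatch s t k = true) :
    ∃ j < k, s[j]? ≠ t[j]? := by
  induction s generalizing t k with
  | nil => simp [mismatch] at h
  | cons a s ih =>
    obtain _ | ⟨b, t⟩ := t
    · simp [mismatch] at h
    obtain _ | k := k
    · simp [mismatch] at h
    simp only [mismatch, Bool.or_eq_true, bne_iff_ne] at h
    rcases h with h | h
    · exact ⟨0, by omega, by simpa using h⟩
    · obtain ⟨j, hj, hne⟩ := ih h
      exact ⟨j + 1, by omega, by simpa using hne⟩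

/-- No prefix of `s` is a square of period `p, …, p + k - 1`, except for `00`, `11` and `0101`.
Here `t` is `s` without its first `p` letters. -/
def noPrefixSquares (s : List (Fin 2)) : List (Fin 2) → ℕ → ℕ → Bool
  | t, p, k + 1 => (mismatch s t p || [[0, 0], [1, 1], [0, 1, 0, 1]].contains (s.take (2 * p))) &&
      noPrefixSquares s t.tail (p + 1) k
  | _, _, 0 => true

theorem mismatch_of_noPrefixSquares {s : List (Fin 2)} {p k : ℕ}
    (h : noPrefixSquares s (s.drop p) p k = true) {q : ℕ} (hpq : p ≤ q) (hq : q < p + k) :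
    mismatch s (s.drop q) q = true ∨
      s.take (2 * q) ∈ ([[0, 0], [1, 1], [0, 1, 0, 1]] : List (List (Fin 2))) := by
  induction k generalizing p with
  | zero => omega
  | succ k ih =>
    simp only [noPrefixSquares, Bool.and_eq_true, Bool.or_eq_true, List.tail_drop,
      List.contains_iff_mem] at h
    rcases hpq.eq_or_lt with rfl | hlt
    · exact h.1
    · exact ih h.2 hlt (by omega)

/-- No suffix of a word that starts in its first `k` letters has a prefix that is a square of
period `1, …, 89`, except for `00`, `11` and `0101`. -/
def noSquares : List (Fin 2) → ℕ → Bool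
  | s, k + 1 => noPrefixSquares s s.tail 1 89 && noSquares s.tail k
  | _, 0 => true

theorem noPrefixSquares_of_noSquares {s : List (Fin 2)} {k : ℕ} (h : noSquares s k = true)
    {r : ℕ} (hr : r < k) : noPrefixSquares (s.drop r) ((s.drop r).drop 1) 1 89 = true := by
  induction k generalizing s r with
  | zero => omega
  | succ k ih =>
    simp only [noSquares, Bool.and_eq_true] at h
    obtain _ | r := r
    · simpa using h.1
    · simpa [add_comm] using ih h.2 (r := r) (by omega)

theorem noSquares_blockWindows :
    ∀ w ∈ blockWindows, noSquares (w.flatMap blockWord) 27 = true := by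
  decide +kernel

theorem mem_of_square {i p : ℕ} (hp0 : p ≠ 0)
    (h : ∀ j < p, zetaVtm (i + j) = zetaVtm (i + j + p)) :
    (List.range (2 * p)).map (fun j => zetaVtm (i + j)) ∈
      ([[0, 0], [1, 1], [0, 1, 0, 1]] : List (List (Fin 2))) := by
  have hp : p < 90 := by
    by_contra hp
    exact not_square_of_le (not_lt.1 hp) h
  have hi := Nat.div_add_mod i 27
  have hir : i % 27 < 27 := Nat.mod_lt _ (by norm_num)
  have hw := noPrefixSquares_of_noSquares
    (noSquares_blockWindows _ (block_window_mem (i / 27))) hir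
  rw [flatMap_blockWord] at hw
  -- Eight blocks have 216 letters; a square of period at most 89 starting in the first block needs
  -- at most `26 + 178`.
  have hget : ∀ j < 180, (((List.range (27 * 8)).map fun j =>
      zetaVtm (27 * (i / 27) + j)).drop (i % 27))[j]? = some (zetaVtm (i + j)) := by
    intro j hj
    rw [List.getElem?_drop, List.getElem?_map, List.getElem?_range (by omega)]
    simp only [Option.map_some, Option.some.injEq]
    congr 1
    omega
  rcases mismatch_of_noPrefixSquares hw (Nat.one_le_iff_ne_zero.2 hp0) (by omega) with hm | hm
  · obtain ⟨j, hj, hne⟩ := exists_of_mismatch hm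
    rw [hget j (by omega), List.getElem?_drop, hget (p + j) (by omega), h j hj,
      show i + (p + j) = i + j + p by ring] at hne
    exact absurd rfl hne
  · convert hm using 1
    refine List.ext_getElem? fun j => ?_
    by_cases hj : j < 2 * p
    · rw [List.getElem?_take_of_lt hj, hget j (by omega)]
      simp [hj]
    · rw [List.getElem?_eq_none (by simpa using hj), List.getElem?_eq_none (by simp; omega)]

theorem squaresIn_zetaVtm : squaresIn zetaVtm = {[0, 0], [1, 1], [0, 1, 0, 1]} := by
  refine Set.Subset.antisymm ?_ ?_
  · rintro w ⟨u, hu, rfl, i, hi⟩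
    rw [List.length_append, ← two_mul] at hi
    have hget : ∀ j < 2 * u.length, (u ++ u)[j]? = some (zetaVtm (i + j)) := by
      intro j hj
      rw [hi]
      simp [hj]
    have := mem_of_square (i := i) (p := u.length) (by simpa using hu) fun j hj => by
      have h1 := hget j (by omega)
      have h2 := hget (j + u.length) (by omega)
      rw [List.getElem?_append_right (by omega), Nat.add_sub_cancel] at h2
      rw [List.getElem?_append_left hj, h2] at h1
      rw [add_assoc]
      exact (Option.some.inj h1).symm
    rw [← hi] at this
    simpa using this
  · have h : ∀ j < 27, zetaVtm j = (blockWord 0).getD j 0 := by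
      intro j hj
      simpa [block_zero] using zetaVtm_block 0 j hj
    have hfac : ∀ (w : List (Fin 2)) (i : ℕ), i + w.length ≤ 27 →
        w = (List.range w.length).map (fun j => (blockWord 0).getD (i + j) 0) →
        IsFactor w zetaVtm := by
      intro w i hi hw
      refine ⟨i, hw.trans (List.map_congr_left fun j hj => ?_)⟩
      have := List.mem_range.1 hj
      exact (h _ (by omega)).symm
    rintro w (rfl | rfl | rfl)
    · exact ⟨[0], by simp, rfl, hfac _ 3 (by decide) (by decide)⟩
    · exact ⟨[1], by simp, rfl, hfac _ 0 (by decide) (by decide)⟩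
    · exact ⟨[0, 1], by simp, rfl, hfac _ 16 (by decide) (by decide)⟩

end FewSquares

theorem theorem4 :
    ((FewSquares.zeta 0).length = 24 ∧ (FewSquares.zeta 1).length = 27 ∧
      (FewSquares.zeta 2).length = 30) ∧
    FewSquares.squaresIn FewSquares.zetaVtm = {[0, 0], [1, 1], [0, 1, 0, 1]} ∧
    IsLeast (FewSquares.stateCounts 2 FewSquares.zetaVtm) 88 ∧
    IsLeast (FewSquares.automaticWeights 2 FewSquares.zetaVtm) 176 :=
  ⟨⟨rfl, rfl, rfl⟩, FewSquares.squaresIn_zetaVtm, FewSquares.isLeast_stateCounts,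
    FewSquares.isLeast_automaticWeights⟩
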